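/- Let $E$ be a complex Banach space that is symmetrically regular, i.e. every continuous linear map $T\colon E\to E'$ with $Tx(y)=Ty(x)$ for all $x,y\in E$ is weakly compact. Let $H_b(E)$ be the algebra of entire functions on $E$ that are bounded on bounded sets, with the topology of uniform convergence on bounded sets, and let $M_b(E)$ be its spectrum, the set of nonzero continuous multiplicative linear functionals on $H_b(E)$. Let $\pi\colon M_b(E)\to E''$, $\pi(\varphi)=\varphi|_{E'}$. For $\varphi\in M_b(E)$ and $z\in E''$ let $\varphi^z\in M_b(E)$ be given by $$\varphi^z(f)=\sum_{n\ge 0}\varphi\Big(y\mapsto \tfrac1{n!}\widetilde{d^nf(y)}(z,\dots,z)\Big)\qquad (f\in H_b(E)),$$ where $\widetilde{d^nf(y)}$ is the Aron--Berner extension of $d^nf(y)$ to $E''$. Give $M_b(E)$ the topology generated by the sets $\{\varphi^z: z\in E'',\ \|z\|<\varepsilon\}$, $\varphi\in M_b(E)$, $\varepsilon>0$, for which $(M_b(E),\pi)$ is a Riemann domain over $E''$. The canonical extension of $f\in H_b(E)$ to $M_b(E)$ is $\tilde f(\varphi)=\varphi(f)$. For a Riemann domain $(X,p)$ over a Banach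 space, $dist_X(x)\in(0,\infty]$ is the supremum of the $r>0$ such that $p$ maps some neighbourhood of $x$ homeomorphically onto the ball $B(p(x),r)$. A set $A\subset X$ is $X$-bounded if $p(A)$ is bounded and $\inf_{x\in A}dist_X(x)>0$. A holomorphic function on $X$ is of bounded type if it is bounded on every $X$-bounded set. Suppose that there is a continuous polynomial on $E$ which is not weakly continuous on bounded sets (i.e. whose restriction to some bounded set is not continuous for the weak topology). Then there is a continuous homogeneous polynomial $P$ on $E$ whose canonical extension $\tilde P$ is holomorphic on $M_b(E)$ but not of bounded type on $(M_b(E),\pi)$, although for every sheet (connected component) $S$ of $M_b(E)$ the restriction $\tilde P|_S$ is of bounded type on the Riemann domain $(S,\pi|_S)$. -/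

import Mathlib

set_option maxSynthPendingDepth 3

open Set Filter Topology

noncomputable section

namespace HbSpectrum

/-! ### Riemann domains spread over a normed space

A Riemann domain over `F` is a Hausdorff space `X` together with a local homeomorphism `p : X → F`.
The notions below are those of the domain `(X, p)`. -/

section RiemannDomain

variable {F : Type*} [NormedAddCommGroup F] [NormedSpace ℂ F]
variable {X : Type*} [TopologicalSpace X]

/-- The boundary distance of the point `x` in `(X, p)`: the supremum, in `[0, ∞]`, of the radii
`r > 0` such that `p` maps some neighbourhood of `x` homeomorphically onto the ball `B(p x, r)`. -/
def boundaryDist (p : X → F) (x : X) : ENNReal :=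
  ⨆ (r : ℝ) (_ : 0 < r ∧ ∃ V ∈ 𝓝 x, IsEmbedding (V.domRestrict p) ∧ p '' V = Metric.ball (p x) r),
    ENNReal.ofReal r

/-- `A` is `X`-bounded: `p(A)` is bounded and `A` is bounded away from the boundary. -/
def IsDomainBounded (p : X → F) (A : Set X) : Prop :=
  Bornology.IsBounded (p '' A) ∧ 0 < ⨅ x ∈ A, boundaryDist p x

/-- `f` is holomorphic on `(X, p)`: near each point it is `p` followed by an analytic function. -/
def IsHolomorphic (p : X → F) (f : X → ℂ) : Prop :=
  ∀ x, ∃ g : F → ℂ, AnalyticAt ℂ g (p x) ∧ f =ᶠ[𝓝 x] g ∘ p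

/-- `f` is of bounded type on `(X, p)`: it is holomorphic and bounded on all `X`-bounded sets. -/
def IsOfBoundedType (p : X → F) (f : X → ℂ) : Prop :=
  IsHolomorphic p f ∧ ∀ A, IsDomainBounded p A → ∃ C : ℝ, ∀ x ∈ A, ‖f x‖ ≤ C

end RiemannDomain

variable (E : Type*) [NormedAddCommGroup E] [NormedSpace ℂ E]

/-- The bidual `E''`, with its usual norm. -/
abbrev Bidual : Type _ := StrongDual ℂ (StrongDual ℂ E)

/-- `E` is symmetrically regular: each continuous linear `T : E → E'` with `T x y = T y x` is
weakly compact, i.e. maps the unit ball to a relatively weakly compact subset of `E'`. -/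
def SymmetricallyRegular : Prop :=
  ∀ T : E →L[ℂ] StrongDual ℂ E, (∀ x y, T x y = T y x) →
    IsCompact (closure (toWeakSpace ℂ (StrongDual ℂ E) '' (T '' Metric.closedBall 0 1)))

variable {E}

/-! ### Polynomials -/

/-- `P` is a continuous `n`-homogeneous polynomial. -/
def IsHomogeneousPolynomial (n : ℕ) (P : E → ℂ) : Prop :=
  ∃ A : ContinuousMultilinearMap ℂ (fun _ : Fin n => E) ℂ, ∀ x, P x = A (fun _ => x)

/-- `P` is a continuous polynomial: a finite sum of continuous homogeneous polynomials. -/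
def IsContinuousPolynomial (P : E → ℂ) : Prop :=
  ∃ (d : ℕ) (Q : ℕ → E → ℂ), (∀ n, IsHomogeneousPolynomial n (Q n)) ∧
    ∀ x, P x = ∑ n ∈ Finset.range (d + 1), Q n x

/-- The restriction of `P` to each bounded set is continuous for the weak topology. -/
def WeaklyContinuousOnBoundedSets (P : E → ℂ) : Prop :=
  ∀ B : Set E, Bornology.IsBounded B →
    ContinuousOn (fun x : WeakSpace ℂ E => P ((toWeakSpace ℂ E).symm x)) (toWeakSpace ℂ E '' B)

/-! ### The Aron–Berner extension of multilinear forms -/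

/-- Given a continuous linear map `T` from `E` to the `n`-linear forms on `E''`, the
`(n + 1)`-linear form `(z₀, z₁, …, zₙ) ↦ z₀ (x ↦ T(x)(z₁, …, zₙ))` on `E''`. -/
def extendFirst (n : ℕ) :
    (E →L[ℂ] ContinuousMultilinearMap ℂ (fun _ : Fin n => Bidual E) ℂ) →L[ℂ]
      ContinuousMultilinearMap ℂ (fun _ : Fin (n + 1) => Bidual E) ℂ :=
  let flipL := (ContinuousLinearMap.flipMultilinearEquiv ℂ
    (fun _ : Fin n => Bidual E) E ℂ).toContinuousLinearMap
  let compL := ((ContinuousLinearMap.compContinuousMultilinearMapL ℂ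
    (fun _ : Fin n => Bidual E) (StrongDual ℂ E) ℂ).flip.comp flipL)
  let unc := (continuousMultilinearCurryLeftEquiv ℂ (fun _ : Fin (n + 1) => Bidual E)
    ℂ).symm.toContinuousLinearEquiv.toContinuousLinearMap
  unc.comp compL

theorem extendFirst_apply (n : ℕ)
    (T : E →L[ℂ] ContinuousMultilinearMap ℂ (fun _ : Fin n => Bidual E) ℂ)
    (z : Fin (n + 1) → Bidual E) :
    extendFirst n T z = z 0 (T.flipMultilinear (Fin.tail z)) := rfl

variable (E) in
/-- The Aron–Berner extension of continuous `n`-linear forms from `E` to `E''`, extending one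
variable at a time: see `aronBerner_zero` and `aronBerner_succ`. -/
def aronBerner : (n : ℕ) →
    (ContinuousMultilinearMap ℂ (fun _ : Fin n => E) ℂ →L[ℂ]
      ContinuousMultilinearMap ℂ (fun _ : Fin n => Bidual E) ℂ)
  | 0 =>
    (continuousMultilinearCurryFin0 ℂ
        (Bidual E) ℂ).symm.toContinuousLinearEquiv.toContinuousLinearMap.comp
      (continuousMultilinearCurryFin0 ℂ E ℂ).toContinuousLinearEquiv.toContinuousLinearMap
  | n + 1 =>
    (extendFirst n).comp <|
      (ContinuousLinearMap.compL ℂ E (ContinuousMultilinearMap ℂ (fun _ : Fin n => E) ℂ)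
          (ContinuousMultilinearMap ℂ (fun _ : Fin n => Bidual E) ℂ) (aronBerner n)).comp
        (continuousMultilinearCurryLeftEquiv ℂ (fun _ : Fin (n + 1) => E)
          ℂ).toContinuousLinearEquiv.toContinuousLinearMap

theorem aronBerner_zero (A : ContinuousMultilinearMap ℂ (fun _ : Fin 0 => E) ℂ)
    (z : Fin 0 → Bidual E) : aronBerner E 0 A z = A 0 := rfl

/-- The extension of `A(x₀, x₁, …, xₙ)` at `(z₀, z₁, …, zₙ)` is the value of `z₀` at a functional,
which by `aronBerner_succ_functional` is `x ↦ (extension of A(x, ·, …, ·))(z₁, …, zₙ)`. -/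
theorem aronBerner_succ (n : ℕ) (A : ContinuousMultilinearMap ℂ (fun _ : Fin (n + 1) => E) ℂ)
    (z : Fin (n + 1) → Bidual E) :
    aronBerner E (n + 1) A z = z 0
      (((aronBerner E n).comp A.curryLeft).flipMultilinear (Fin.tail z)) := rfl

theorem aronBerner_succ_functional (n : ℕ)
    (A : ContinuousMultilinearMap ℂ (fun _ : Fin (n + 1) => E) ℂ)
    (z : Fin (n + 1) → Bidual E) (x : E) :
    ((aronBerner E n).comp A.curryLeft).flipMultilinear (Fin.tail z) x =
      aronBerner E n (A.curryLeft x) (Fin.tail z) := rfl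

/-- The Aron–Berner extension extends `A` along the canonical embedding of `E` into `E''`. -/
theorem aronBerner_inclusion (n : ℕ) (A : ContinuousMultilinearMap ℂ (fun _ : Fin n => E) ℂ)
    (x : Fin n → E) :
    aronBerner E n A (fun i => NormedSpace.inclusionInDoubleDual ℂ E (x i)) = A x := by
  induction n with
  | zero => rw [aronBerner_zero]; congr 1; exact Subsingleton.elim _ _
  | succ n ih =>
    rw [aronBerner_succ, NormedSpace.dual_def, aronBerner_succ_functional]
    refine (ih (A.curryLeft (x 0)) (Fin.tail x)).trans ?_
    rw [ContinuousMultilinearMap.curryLeft_apply, Fin.cons_self_tail]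

/-! ### The algebra of entire functions of bounded type -/

theorem bounded_fderiv {G : Type*} [NormedAddCommGroup G] [NormedSpace ℂ G] {f : E → G}
    (hf : Differentiable ℂ f)
    (hb : ∀ B : Set E, Bornology.IsBounded B → ∃ C : ℝ, ∀ x ∈ B, ‖f x‖ ≤ C)
    (B : Set E) (hB : Bornology.IsBounded B) : ∃ C : ℝ, ∀ x ∈ B, ‖fderiv ℂ f x‖ ≤ C := by
  obtain ⟨R, hR⟩ := hB.subset_closedBall 0
  obtain ⟨C, hC⟩ := hb (Metric.closedBall 0 (R + 1)) Metric.isBounded_closedBall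
  refine ⟨max C 0, fun x hx => ?_⟩
  have hxR : ‖x‖ ≤ R := by simpa using hR hx
  refine ContinuousLinearMap.opNorm_le_of_unit_norm (𝕜 := ℂ) (le_max_right _ _) fun v hv => ?_
  have hline : ∀ t : ℂ, HasDerivAt (fun t : ℂ => x + t • v) v t := fun t => by
    simpa using ((hasDerivAt_id t).smul_const v).const_add x
  have hd : HasDerivAt (fun t : ℂ => f (x + t • v)) (fderiv ℂ f x v) 0 := by
    have h1 : HasFDerivAt f (fderiv ℂ f x) (x + (0 : ℂ) • v) := by
      simpa using (hf x).hasFDerivAt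
    exact h1.comp_hasDerivAt (0 : ℂ) (hline 0)
  have hdiff : Differentiable ℂ (fun t : ℂ => f (x + t • v)) :=
    hf.comp fun t => (hline t).differentiableAt
  have := Complex.norm_deriv_le_of_forall_mem_sphere_norm_le (c := (0 : ℂ)) (R := 1) (C := C)
    one_pos hdiff.diffContOnCl (fun t ht => hC _ (by
      have ht1 : ‖t‖ = 1 := by simpa using ht
      have : ‖x + t • v‖ ≤ R + 1 := (norm_add_le _ _).trans (by
        rw [norm_smul, ht1, hv]; linarith)
      simpa using this))
  rw [hd.deriv] at this
  exact (by simpa using this : _ ≤ C).trans (le_max_left _ _)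

theorem bounded_iteratedFDeriv {f : E → ℂ} (hf : AnalyticOnNhd ℂ f univ)
    (hb : ∀ B : Set E, Bornology.IsBounded B → ∃ C : ℝ, ∀ x ∈ B, ‖f x‖ ≤ C) (n : ℕ) :
    ∀ B : Set E, Bornology.IsBounded B → ∃ C : ℝ, ∀ x ∈ B, ‖iteratedFDeriv ℂ n f x‖ ≤ C := by
  induction n with
  | zero => simpa using hb
  | succ n ih =>
    simp only [← norm_fderiv_iteratedFDeriv]
    exact bounded_fderiv (fun x => (hf.iteratedFDeriv n x (mem_univ x)).differentiableAt) ih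

variable (E) in
/-- `H_b(E)`: the algebra of entire functions on `E` that are bounded on bounded sets. -/
def Hb : Subalgebra ℂ (E → ℂ) where
  carrier := {f | AnalyticOnNhd ℂ f univ ∧
    ∀ B : Set E, Bornology.IsBounded B → ∃ C : ℝ, ∀ x ∈ B, ‖f x‖ ≤ C}
  mul_mem' := by
    rintro f g ⟨hf, hfb⟩ ⟨hg, hgb⟩
    refine ⟨hf.mul hg, fun B hB => ?_⟩
    obtain ⟨C, hC⟩ := hfb B hB
    obtain ⟨D, hD⟩ := hgb B hB
    refine ⟨C * D, fun x hx => ?_⟩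
    rw [Pi.mul_apply, norm_mul]
    exact mul_le_mul (hC x hx) (hD x hx) (norm_nonneg _) ((norm_nonneg _).trans (hC x hx))
  add_mem' := by
    rintro f g ⟨hf, hfb⟩ ⟨hg, hgb⟩
    refine ⟨hf.add hg, fun B hB => ?_⟩
    obtain ⟨C, hC⟩ := hfb B hB
    obtain ⟨D, hD⟩ := hgb B hB
    exact ⟨C + D, fun x hx => (norm_add_le _ _).trans (add_le_add (hC x hx) (hD x hx))⟩
  algebraMap_mem' c :=
    ⟨analyticOnNhd_const, fun B _ => ⟨‖c‖, fun x _ => le_of_eq rfl⟩⟩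

variable (E) in
/-- The topology of `H_b(E)`: uniform convergence on bounded sets. -/
abbrev hbTopology : TopologicalSpace (Hb E) :=
  TopologicalSpace.induced
    (fun f => UniformOnFun.ofFun {B : Set E | Bornology.IsBounded B} (f : E → ℂ)) inferInstance

/-- A continuous linear functional, as an element of `H_b(E)`. -/
def ofDual : StrongDual ℂ E →ₗ[ℂ] Hb E where
  toFun γ := ⟨γ, fun x _ => γ.analyticAt x, fun B hB => by
    obtain ⟨R, hR⟩ := hB.subset_closedBall 0
    refine ⟨‖γ‖ * R, fun x hx => (γ.le_opNorm x).trans ?_⟩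
    exact mul_le_mul_of_nonneg_left (by simpa using hR hx) (norm_nonneg _)⟩
  map_add' _ _ := rfl
  map_smul' _ _ := rfl

theorem continuous_ofDual : Continuous[_, hbTopology E] (ofDual (E := E)) := by
  rw [continuous_iff_le_induced, hbTopology, induced_compose, ← continuous_iff_le_induced]
  have h := (ContinuousLinearMap.isUniformEmbedding_toUniformOnFun (σ := RingHom.id ℂ) (E := E) (F := ℂ))
    |>.uniformContinuous.continuous
  have hs : {B : Set E | Bornology.IsVonNBounded ℂ B} = {B : Set E | Bornology.IsBounded B} := by
    ext B; exact NormedSpace.isVonNBounded_iff ℂ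
  rw [hs] at h
  exact h

/-- For `f ∈ H_b(E)` and `z ∈ E''`, the function `y ↦ D̃ⁿf(y)(z, …, z)`, where `D̃ⁿf(y)` is the
Aron–Berner extension of the `n`-th differential of `f` at `y`. -/
def bidualDifferential (n : ℕ) (z : Bidual E) (f : Hb E) : Hb E :=
  ⟨fun y => aronBerner E n (iteratedFDeriv ℂ n (f : E → ℂ) y) (fun _ => z), by
    let L : ContinuousMultilinearMap ℂ (fun _ : Fin n => E) ℂ →L[ℂ] ℂ :=
      (ContinuousMultilinearMap.apply ℂ (fun _ : Fin n => Bidual E) ℂ (fun _ => z)).comp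
        (aronBerner E n)
    refine ⟨fun y hy => (L.analyticAt _).comp (f.2.1.iteratedFDeriv n y hy), fun B hB => ?_⟩
    obtain ⟨C, hC⟩ := bounded_iteratedFDeriv f.2.1 f.2.2 n B hB
    exact ⟨‖L‖ * C, fun y hy => (L.le_opNorm _).trans
      (mul_le_mul_of_nonneg_left (hC y hy) (norm_nonneg _))⟩⟩

/-! ### The spectrum as a Riemann domain over the bidual -/

variable (E) in
/-- `M_b(E)`: the spectrum of `H_b(E)`. A nonzero multiplicative linear functional is the same as a
unital algebra homomorphism to `ℂ`. -/
structure Mb where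
  /-- the underlying homomorphism -/
  toAlgHom : Hb E →ₐ[ℂ] ℂ
  /-- continuity for uniform convergence on bounded sets -/
  continuous' : Continuous[hbTopology E, _] toAlgHom

/-- The canonical extension of `f ∈ H_b(E)` to the spectrum, `φ ↦ φ(f)`. -/
def canonicalExtension (f : Hb E) (φ : Mb E) : ℂ := φ.toAlgHom f

/-- `π : M_b(E) → E''`, `π(φ)(γ) = φ(γ)`. -/
def proj (φ : Mb E) : Bidual E :=
  { toLinearMap := φ.toAlgHom.toLinearMap ∘ₗ ofDual
    cont := @Continuous.comp _ _ _ _ (hbTopology E) _ _ _ φ.continuous' continuous_ofDual }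

/-- `ψ = φ^z`, that is `ψ(f) = ∑ₙ φ(y ↦ D̃ⁿf(y)(z, …, z) / n!)` for all `f ∈ H_b(E)`. -/
def IsTranslate (φ : Mb E) (z : Bidual E) (ψ : Mb E) : Prop :=
  ∀ f : Hb E, HasSum
    (fun n : ℕ => ((n.factorial : ℂ))⁻¹ * φ.toAlgHom (bidualDifferential n z f)) (ψ.toAlgHom f)

/-- The topology of the Riemann domain `(M_b(E), π)`: it is generated by the sets
`{φ^z : z ∈ E'', ‖z‖ < ε}` with `φ ∈ M_b(E)` and `ε > 0`. -/
instance : TopologicalSpace (Mb E) :=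
  TopologicalSpace.generateFrom
    {V | ∃ (φ : Mb E) (ε : ℝ), 0 < ε ∧ V = {ψ | ∃ z : Bidual E, ‖z‖ < ε ∧ IsTranslate φ z ψ}}

end HbSpectrum

end

/-! Write `D_z f(y) = z(df(y))` for `z ∈ E''`. The Aron–Berner term in the series for `φ^z` is
`D_z^n f`, so `φ^z = φ ∘ exp(D_z)`. Since `D_z` is a derivation, `φ^z` is multiplicative; Cauchy
estimates give convergence and continuity. Symmetric regularity enters through Arens: the second
derivative of `f` is a symmetric, hence weakly compact, operator `E → E'`, and this makes `D_z` and
`D_w` commute. Therefore `(φ^z)^w = φ^(z+w)`.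

Thus `M_b(E)` splits into clopen orbits `{φ^z : z ∈ E''}`, each mapped homeomorphically onto `E''`
by `π`. The boundary distance is infinite everywhere, so being `X`-bounded only means having bounded
image under `π`. A sheet lies in one orbit, where `φ^z(f)` is bounded for `‖z‖ ≤ ρ` by the Cauchy
estimates; so every canonical extension is of bounded type on each sheet.

Across sheets this fails. A homogeneous polynomial `Q` of minimal degree that is not weakly
continuous on bounded sets tends to some `c ≠ 0` along a bounded, weakly null ultrafilter `V`
(`exists_weaklyNull_ultrafilter`). Limits along the dilated ultrafilters `kV` are homomorphisms
`φ_k` with `π(φ_k) = 0` and `φ_k(Q) = k^n c`. They form an `X`-bounded set on which the extension of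
`Q` is unbounded. -/

open scoped TensorProduct

noncomputable section

namespace HbSpectrum

variable {E : Type*} [NormedAddCommGroup E] [NormedSpace ℂ E]

/-! ### Directional derivatives along the bidual -/

/-- `‖f x‖ ≤ M` for `‖x‖ ≤ R`. -/
def BoundedOnBall {F : Type*} [NormedAddCommGroup F] (f : F → ℂ) (R M : ℝ) : Prop := ∀ x, ‖x‖ ≤ R → ‖f x‖ ≤ M

theorem BoundedOnBall.mono {F : Type*} [NormedAddCommGroup F] {f : F → ℂ} {R R' M : ℝ} (h : BoundedOnBall f R M) (hR : R' ≤ R) :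
    BoundedOnBall f R' M := fun x hx => h x (hx.trans hR)

theorem exists_boundedOnBall (f : Hb E) (R : ℝ) : ∃ M, 0 ≤ M ∧ BoundedOnBall (f : E → ℂ) R M := by
  obtain ⟨C, hC⟩ := f.2.2 (Metric.closedBall 0 R) Metric.isBounded_closedBall
  exact ⟨max C 0, le_max_right _ _, fun x hx => (hC x (by simpa using hx)).trans (le_max_left _ _)⟩

theorem differentiable_hb (f : Hb E) : Differentiable ℂ (f : E → ℂ) :=
  fun x => (f.2.1 x (mem_univ x)).differentiableAt

theorem BoundedOnBall.norm_fderiv_le {f : E → ℂ} (hf : Differentiable ℂ f) {R s M : ℝ}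
    (hs : 0 < s) (h : BoundedOnBall f (R + s) M) {x : E} (hx : ‖x‖ ≤ R) :
    ‖fderiv ℂ f x‖ ≤ M / s := by
  have hM : 0 ≤ M := (norm_nonneg _).trans (h x (by linarith))
  refine ContinuousLinearMap.opNorm_le_of_unit_norm (𝕜 := ℂ) (by positivity) fun v hv => ?_
  have hline : ∀ t : ℂ, HasDerivAt (fun t : ℂ => x + t • v) v t := fun t => by
    simpa using ((hasDerivAt_id t).smul_const v).const_add x
  have hd : HasDerivAt (fun t : ℂ => f (x + t • v)) (fderiv ℂ f x v) 0 := by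
    have h1 : HasFDerivAt f (fderiv ℂ f x) (x + (0 : ℂ) • v) := by
      simpa using (hf x).hasFDerivAt
    exact h1.comp_hasDerivAt (0 : ℂ) (hline 0)
  have hdiff : Differentiable ℂ (fun t : ℂ => f (x + t • v)) :=
    hf.comp fun t => (hline t).differentiableAt
  rw [← hd.deriv]
  refine Complex.norm_deriv_le_of_forall_mem_sphere_norm_le hs hdiff.diffContOnCl fun t ht => ?_
  have ht1 : ‖t‖ = s := by simpa using ht
  refine h _ ((norm_add_le _ _).trans ?_)
  rw [norm_smul, ht1, hv]; linarith

variable (E) in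
/-- The derivative in the direction `z ∈ E''`: `directional E z f y = z (df(y))`. -/
def directional : Bidual E →ₗ[ℂ] Module.End ℂ (Hb E) :=
  LinearMap.mk₂ ℂ (fun z f => ⟨fun y => z (fderiv ℂ (f : E → ℂ) y),
      fun y _ => (z.analyticAt _).comp (f.2.1.fderiv y (mem_univ y)), fun B hB => by
        obtain ⟨C, hC⟩ := bounded_fderiv (differentiable_hb f) f.2.2 B hB
        exact ⟨‖z‖ * C, fun y hy => (z.le_opNorm _).trans
          (mul_le_mul_of_nonneg_left (hC y hy) (norm_nonneg _))⟩⟩)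
    (fun _ _ _ => rfl) (fun _ _ _ => rfl)
    (fun z f g => Subtype.ext <| funext fun y => by
      change z (fderiv ℂ ((f : E → ℂ) + g) y) = z _ + z _
      rw [fderiv_add (differentiable_hb f y) (differentiable_hb g y), map_add])
    (fun c z f => Subtype.ext <| funext fun y => by
      change z (fderiv ℂ (c • (f : E → ℂ)) y) = c • z _
      rw [fderiv_const_smul (differentiable_hb f y), map_smul])

theorem directional_apply (z : Bidual E) (f : Hb E) (y : E) :
    (directional E z f : E → ℂ) y = z (fderiv ℂ (f : E → ℂ) y) := rfl

theorem directional_mul (z : Bidual E) (f g : Hb E) :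
    directional E z (f * g) = f * directional E z g + directional E z f * g := by
  ext y
  change z (fderiv ℂ ((f : E → ℂ) * g) y) = (f : E → ℂ) y * z _ + z _ * (g : E → ℂ) y
  rw [fderiv_mul (differentiable_hb f y) (differentiable_hb g y), map_add, map_smul, map_smul]
  simp [mul_comm]

theorem directional_one (z : Bidual E) : directional E z 1 = 0 := by
  ext y
  change z (fderiv ℂ (fun _ : E => (1 : ℂ)) y) = 0
  simp

theorem directional_ofDual (z : Bidual E) (γ : StrongDual ℂ E) :
    directional E z (ofDual γ) = z γ • (1 : Hb E) := by
  ext y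
  change z (fderiv ℂ (γ : E → ℂ) y) = z γ * 1
  rw [γ.fderiv, mul_one]

/-- The Aron–Berner extension treats one variable at a time and is a bounded linear operator on
forms, so it commutes with differentiation in `y`; each extended variable costs one application of
`D_z`. -/
theorem bidualDifferential_eq_pow (n : ℕ) (z : Bidual E) (f : Hb E) :
    bidualDifferential n z f = (directional E z ^ n) f := by
  induction n with
  | zero => ext y; rfl
  | succ n ih =>
    rw [pow_succ', Module.End.mul_apply, ← ih]
    ext y
    rw [directional_apply]
    change aronBerner E (n + 1) (iteratedFDeriv ℂ (n + 1) (f : E → ℂ) y) (fun _ => z) =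
      z (fderiv ℂ (fun y => aronBerner E n (iteratedFDeriv ℂ n (f : E → ℂ) y) (fun _ => z)) y)
    rw [aronBerner_succ]
    congr 1
    ext x
    rw [aronBerner_succ_functional]
    have h1 : HasFDerivAt (iteratedFDeriv ℂ n (f : E → ℂ))
        (fderiv ℂ (iteratedFDeriv ℂ n (f : E → ℂ)) y) y :=
      (f.2.1.iteratedFDeriv n y (mem_univ y)).differentiableAt.hasFDerivAt
    let L : ContinuousMultilinearMap ℂ (fun _ : Fin n => E) ℂ →L[ℂ] ℂ :=
      (ContinuousMultilinearMap.apply ℂ (fun _ : Fin n => Bidual E) ℂ (fun _ => z)).comp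
        (aronBerner E n)
    have h2 := (L.hasFDerivAt.comp y h1).fderiv
    change fderiv ℂ (fun y => aronBerner E n (iteratedFDeriv ℂ n (f : E → ℂ) y) (fun _ => z)) y
      = _ at h2
    rw [h2]
    rfl

/-! ### Cauchy estimates -/

theorem BoundedOnBall.directional {f : Hb E} {R s M : ℝ} (hs : 0 < s)
    (h : BoundedOnBall (f : E → ℂ) (R + s) M) (z : Bidual E) :
    BoundedOnBall (directional E z f : E → ℂ) R (‖z‖ / s * M) := fun x hx => by
  rw [directional_apply, div_mul_eq_mul_div, mul_div_assoc]
  exact (z.le_opNorm _).trans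
    (mul_le_mul_of_nonneg_left (h.norm_fderiv_le (differentiable_hb f) hs hx) (norm_nonneg _))

theorem BoundedOnBall.directional_prod {s : ℝ} (hs : 0 < s) (l : List (Bidual E)) {f : Hb E}
    {R M : ℝ} (h : BoundedOnBall (f : E → ℂ) (R + l.length * s) M) :
    BoundedOnBall ((l.map (HbSpectrum.directional E)).prod f : E → ℂ) R
      ((l.map fun z => ‖z‖ / s).prod * M) := by
  induction l generalizing R with
  | nil => simpa using h
  | cons z l ih =>
    have h1 := ih (R := R + s) (h.mono (by simp; linarith))
    simpa [Module.End.mul_apply, mul_assoc] using h1.directional hs z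

theorem pow_self_div_factorial_le (n : ℕ) : (n : ℝ) ^ n / n.factorial ≤ Real.exp 1 ^ n := by
  rw [← Real.exp_nat_mul, mul_one]
  exact Real.pow_div_factorial_le_exp n (Nat.cast_nonneg n) n

theorem BoundedOnBall.directional_ofFn {r : ℝ} (hr : 0 < r) {n : ℕ} (z : Fin n → Bidual E)
    {f : Hb E} {R M : ℝ} (h : BoundedOnBall (f : E → ℂ) (R + r) M) (hM : 0 ≤ M) :
    BoundedOnBall ((List.ofFn fun i => HbSpectrum.directional E (z i)).prod f : E → ℂ) R
      (n.factorial * (Real.exp 1 / r) ^ n * M * ∏ i, ‖z i‖) := by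
  rcases Nat.eq_zero_or_pos n with rfl | hn
  · simpa using h.mono (by linarith)
  have hn' : (0 : ℝ) < n := by exact_mod_cast hn
  -- Each of the `n` derivatives gives up `r / n` of the radius, which costs `(n / r)^n` in all;
  -- `n^n ≤ n! e^n` turns this into the stated constant.
  have h1 := directional_prod (s := r / n) (by positivity) (List.ofFn z) (f := f) (R := R) (M := M)
    (by rw [List.length_ofFn, mul_div_cancel₀ _ hn'.ne']; exact h)
  rw [List.map_ofFn, List.map_ofFn, List.prod_ofFn (f := (fun z => ‖z‖ / (r / n)) ∘ z)] at h1
  refine fun x hx => (h1 x hx).trans ?_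
  have h2 := pow_self_div_factorial_le n
  rw [div_le_iff₀ (by positivity)] at h2
  have h3 : ∏ i, ((fun z => ‖z‖ / (r / n)) ∘ z) i = n ^ n / r ^ n * ∏ i, ‖z i‖ := by
    simp only [Function.comp_apply, div_eq_mul_inv, Finset.prod_mul_distrib]
    rw [Finset.prod_const, Finset.card_univ, Fintype.card_fin, mul_comm]
    congr 1
    rw [mul_inv, inv_inv, mul_pow, inv_pow, mul_comm]
  rw [h3]
  have h4 : (n : ℝ) ^ n / r ^ n ≤ n.factorial * (Real.exp 1 / r) ^ n := by
    rw [div_pow, ← mul_div_assoc]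
    gcongr
    linarith
  have h5 : 0 ≤ ∏ i, ‖z i‖ := Finset.prod_nonneg fun _ _ => norm_nonneg _
  calc _ = (n : ℝ) ^ n / r ^ n * (M * ∏ i, ‖z i‖) := by ring
    _ ≤ n.factorial * (Real.exp 1 / r) ^ n * (M * ∏ i, ‖z i‖) := by gcongr
    _ = _ := by ring

theorem BoundedOnBall.directional_pow {r : ℝ} (hr : 0 < r) (n : ℕ) (z : Bidual E)
    {f : Hb E} {R M : ℝ} (h : BoundedOnBall (f : E → ℂ) (R + r) M) (hM : 0 ≤ M) :
    BoundedOnBall ((HbSpectrum.directional E z ^ n) f : E → ℂ) R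
      (n.factorial * ((Real.exp 1 * ‖z‖ / r) ^ n * M)) := by
  have h1 := directional_ofFn hr (fun _ : Fin n => z) h hM
  rw [List.ofFn_const, List.prod_replicate] at h1
  convert h1 using 1
  rw [Finset.prod_const, Finset.card_univ, Fintype.card_fin, mul_div_right_comm, mul_pow]
  ring

/-! ### Continuity of homomorphisms -/

theorem Mb.exists_bound (φ : Mb E) : ∃ R C : ℝ, 0 ≤ R ∧ 0 ≤ C ∧
    ∀ (f : Hb E) (M : ℝ), BoundedOnBall (f : E → ℂ) R M → ‖φ.toAlgHom f‖ ≤ C * M := by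
  let _ : TopologicalSpace (Hb E) := hbTopology E
  have h1 : φ.toAlgHom ⁻¹' Metric.ball 0 1 ∈ 𝓝 (0 : Hb E) :=
    φ.continuous'.continuousAt.preimage_mem_nhds (by
      rw [map_zero]; exact Metric.ball_mem_nhds _ one_pos)
  rw [nhds_induced, Filter.mem_comap] at h1
  obtain ⟨t, ht, hts⟩ := h1
  have hb := UniformOnFun.hasBasis_nhds_of_basis E ℂ {B : Set E | Bornology.IsBounded B}
    (UniformOnFun.ofFun {B : Set E | Bornology.IsBounded B} ((0 : Hb E) : E → ℂ))
    ⟨∅, Bornology.isBounded_empty⟩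
    (fun s hs t ht => ⟨s ∪ t, Bornology.IsBounded.union hs ht, subset_union_left,
      subset_union_right⟩) Metric.uniformity_basis_dist
  obtain ⟨⟨S, ε⟩, ⟨hS, hε⟩, hsub⟩ := hb.mem_iff.1 ht
  obtain ⟨R, hR⟩ := (show Bornology.IsBounded S from hS).subset_closedBall 0
  refine ⟨max R 0, ε⁻¹, le_max_right _ _, (inv_pos.2 hε).le, fun f M hf => ?_⟩
  have hM : 0 ≤ M := (norm_nonneg _).trans (hf 0 (by simp))
  -- The slack `δ` allows rescaling `f` by `ε / (M + δ)` even when `M = 0`, and makes the resulting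
  -- bound strictly less than `ε`.
  have key : ∀ δ : ℝ, 0 < δ → ‖φ.toAlgHom f‖ ≤ ε⁻¹ * M + ε⁻¹ * δ := fun δ hδ => by
    have hMδ : 0 < M + δ := by linarith
    have hmem : (((ε / (M + δ) : ℝ) : ℂ) • f) ∈ φ.toAlgHom ⁻¹' Metric.ball 0 1 := by
      refine hts (hsub ?_)
      intro x hx
      have hx' : ‖f.1 x‖ ≤ M := hf x (by
        have := hR hx
        simp only [mem_closedBall_zero_iff] at this
        exact this.trans (le_max_left _ _))
      change dist (((ε / (M + δ) : ℝ) : ℂ) * f.1 x) (0 : ℂ) < ε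
      rw [dist_zero_right, norm_mul, Complex.norm_real, Real.norm_of_nonneg (by positivity),
        div_mul_eq_mul_div, div_lt_iff₀ hMδ]
      nlinarith [mul_le_mul_of_nonneg_left hx' (le_of_lt hε), mul_pos hε hδ]
    rw [mem_preimage, map_smul, mem_ball_zero_iff, norm_smul, Complex.norm_real,
      Real.norm_of_nonneg (by positivity), div_mul_eq_mul_div, div_lt_iff₀ hMδ, one_mul] at hmem
    rw [← mul_add, ← div_eq_inv_mul, le_div_iff₀ hε]
    linarith
  refine le_of_forall_pos_le_add fun η hη => ?_
  have := key (ε * η) (by positivity)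
  rwa [← mul_assoc, inv_mul_cancel₀ hε.ne', one_mul] at this

theorem continuous_of_bound (φ : Hb E →ₐ[ℂ] ℂ) (R C : ℝ)
    (h : ∀ (f : Hb E) (M : ℝ), BoundedOnBall (f : E → ℂ) R M → ‖φ f‖ ≤ C * M) :
    Continuous[hbTopology E, _] φ := by
  let _ : TopologicalSpace (Hb E) := hbTopology E
  have hC : ∀ η > 0, ∃ ε > 0, C * ε < η := fun η hη =>
    ⟨η / (2 * (|C| + 1)), by positivity, by
      rw [← mul_div_assoc, div_lt_iff₀ (by positivity)]
      nlinarith [le_abs_self C, abs_nonneg C]⟩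
  refine continuous_iff_continuousAt.2 fun f => ?_
  have h1 : Tendsto (fun g : Hb E => UniformOnFun.ofFun {B : Set E | Bornology.IsBounded B}
      (g : E → ℂ)) (𝓝 f) (𝓝 (UniformOnFun.ofFun _ (f : E → ℂ))) :=
    (continuous_induced_dom (f := fun g : Hb E =>
      UniformOnFun.ofFun {B : Set E | Bornology.IsBounded B} (g : E → ℂ))).tendsto f
  rw [UniformOnFun.tendsto_iff_tendstoUniformlyOn] at h1
  have h2 := h1 (Metric.closedBall 0 R) Metric.isBounded_closedBall
  rw [Metric.tendstoUniformlyOn_iff] at h2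
  refine Metric.tendsto_nhds.2 fun η hη => ?_
  obtain ⟨ε, hε, hεη⟩ := hC η hη
  filter_upwards [h2 ε hε] with g hg
  rw [dist_eq_norm, ← map_sub]
  refine (h (g - f) ε fun x hx => ?_).trans_lt hεη
  have := hg x (by simpa using hx)
  rw [dist_comm, dist_eq_norm] at this
  exact this.le

/-! ### Translation of homomorphisms -/

/-- Leibniz formula: multiplication intertwines `D` with `D ⊗ 1 + 1 ⊗ D`, whose summands commute, so
the binomial theorem applies to the powers. -/
theorem directional_pow_mul (z : Bidual E) (n : ℕ) (f g : Hb E) :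
    (directional E z ^ n) (f * g) = ∑ p ∈ Finset.HasAntidiagonal.antidiagonal n,
      n.choose p.1 • ((directional E z ^ p.1) f * (directional E z ^ p.2) g) := by
  set D := directional E z
  have h1 : D ∘ₗ LinearMap.mul' ℂ (Hb E) =
      LinearMap.mul' ℂ (Hb E) ∘ₗ (LinearMap.rTensor (Hb E) D + LinearMap.lTensor (Hb E) D) := by
    refine TensorProduct.ext' fun a b => ?_
    simp [D, directional_mul, add_comm]
  have h2 := Module.End.commute_pow_left_of_commute h1 n
  have h3 : Commute (LinearMap.rTensor (Hb E) D) (LinearMap.lTensor (Hb E) D) := by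
    change _ ∘ₗ _ = _ ∘ₗ _
    rw [LinearMap.rTensor_comp_lTensor, LinearMap.lTensor_comp_rTensor]
  rw [h3.add_pow'] at h2
  have h4 := LinearMap.congr_fun h2 (f ⊗ₜ[ℂ] g)
  simpa [LinearMap.rTensor_pow, LinearMap.lTensor_pow, Module.End.mul_apply,
    -nsmul_eq_mul] using h4

/-- The `n`-th term of the series defining `φ^z(f)`. -/
def translateTerm (φ : Mb E) (z : Bidual E) (f : Hb E) (n : ℕ) : ℂ :=
  (n.factorial : ℂ)⁻¹ * φ.toAlgHom ((directional E z ^ n) f)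

/-- Chooses the loss of radius `r` so large that the Cauchy bounds for the terms of `φ^z(f)` form a
geometric series of ratio at most `1 / 2`. -/
theorem exists_translate_radius (z : Bidual E) :
    ∃ r : ℝ, 0 < r ∧ 0 ≤ Real.exp 1 * ‖z‖ / r ∧ Real.exp 1 * ‖z‖ / r ≤ 1 / 2 :=
  ⟨2 * (Real.exp 1 * ‖z‖ + 1), by positivity, by positivity, by
    rw [div_le_div_iff₀ (by positivity) two_pos]; linarith⟩

theorem norm_translateTerm_le {φ : Mb E} {R C : ℝ}
    (hφ : ∀ (f : Hb E) (M : ℝ), BoundedOnBall (f : E → ℂ) R M → ‖φ.toAlgHom f‖ ≤ C * M)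
    {r : ℝ} (hr : 0 < r) (z : Bidual E) {f : Hb E} {M : ℝ} (hM : 0 ≤ M)
    (h : BoundedOnBall (f : E → ℂ) (R + r) M) (n : ℕ) :
    ‖translateTerm φ z f n‖ ≤ (Real.exp 1 * ‖z‖ / r) ^ n * (C * M) := by
  have h1 := hφ _ _ (h.directional_pow hr n z hM)
  rw [translateTerm, norm_mul, norm_inv, Complex.norm_natCast, ← div_eq_inv_mul,
    div_le_iff₀ (by positivity)]
  exact h1.trans (le_of_eq (by ring))

theorem summable_norm_translateTerm (φ : Mb E) (z : Bidual E) (f : Hb E) :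
    Summable fun n => ‖translateTerm φ z f n‖ := by
  obtain ⟨R, C, -, -, hφ⟩ := φ.exists_bound
  obtain ⟨r, hr, h0, h1⟩ := exists_translate_radius z
  obtain ⟨M, hM, hf⟩ := exists_boundedOnBall f (R + r)
  exact Summable.of_nonneg_of_le (fun _ => norm_nonneg _)
    (norm_translateTerm_le hφ hr z hM hf)
    ((summable_geometric_of_lt_one h0 (by linarith)).mul_right _)

theorem norm_tsum_translateTerm_le {φ : Mb E} {R C : ℝ} (hC : 0 ≤ C)
    (hφ : ∀ (f : Hb E) (M : ℝ), BoundedOnBall (f : E → ℂ) R M → ‖φ.toAlgHom f‖ ≤ C * M)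
    {r : ℝ} (hr : 0 < r) {z : Bidual E} (h1 : Real.exp 1 * ‖z‖ / r ≤ 1 / 2) {f : Hb E} {M : ℝ}
    (hM : 0 ≤ M) (h : BoundedOnBall (f : E → ℂ) (R + r) M) :
    ‖∑' n, translateTerm φ z f n‖ ≤ 2 * C * M := by
  refine tsum_of_norm_bounded (g := fun n => (1 / 2 : ℝ) ^ n * (C * M)) ?_ fun n => ?_
  · rw [mul_assoc]; exact hasSum_geometric_two.mul_right _
  · refine (norm_translateTerm_le hφ hr z hM h n).trans ?_
    have : 0 ≤ Real.exp 1 * ‖z‖ / r := by positivity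
    gcongr

theorem translateTerm_one (φ : Mb E) (z : Bidual E) {n : ℕ} (hn : n ≠ 0) :
    translateTerm φ z 1 n = 0 := by
  obtain ⟨m, rfl⟩ := Nat.exists_eq_succ_of_ne_zero hn
  rw [translateTerm, pow_succ, Module.End.mul_apply, directional_one, map_zero, map_zero, mul_zero]

theorem translateTerm_mul (φ : Mb E) (z : Bidual E) (f g : Hb E) (n : ℕ) :
    translateTerm φ z (f * g) n = ∑ p ∈ Finset.HasAntidiagonal.antidiagonal n,
      translateTerm φ z f p.1 * translateTerm φ z g p.2 := by
  rw [translateTerm, directional_pow_mul, map_sum, Finset.mul_sum]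
  refine Finset.sum_congr rfl fun p hp => ?_
  obtain rfl := Finset.HasAntidiagonal.mem_antidiagonal.1 hp
  have h2 : ((p.1 + p.2).factorial : ℂ) ≠ 0 := by exact_mod_cast Nat.factorial_ne_zero _
  have h3 : (p.1.factorial : ℂ) ≠ 0 := by exact_mod_cast Nat.factorial_ne_zero _
  have h4 : (p.2.factorial : ℂ) ≠ 0 := by exact_mod_cast Nat.factorial_ne_zero _
  rw [nsmul_eq_mul, map_mul, map_mul, map_natCast, translateTerm, translateTerm, Nat.cast_add_choose]
  field_simp

/-- The homomorphism `φ^z`. -/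
def Mb.translate (φ : Mb E) (z : Bidual E) : Mb E where
  toAlgHom := AlgHom.ofLinearMap
    { toFun := fun f => ∑' n, translateTerm φ z f n
      map_add' := fun f g => by
        rw [← (summable_norm_translateTerm φ z f).of_norm.tsum_add
          (summable_norm_translateTerm φ z g).of_norm]
        exact tsum_congr fun n => by simp only [translateTerm, map_add, mul_add]
      map_smul' := fun c f => by
        rw [RingHom.id_apply, smul_eq_mul, ← tsum_mul_left]
        exact tsum_congr fun n => by
          simp only [translateTerm, map_smul, smul_eq_mul]; ring }
    (by
      change ∑' n, translateTerm φ z 1 n = 1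
      rw [tsum_eq_single 0 fun n hn => translateTerm_one φ z hn]
      simp [translateTerm])
    (fun f g => by
      change ∑' n, translateTerm φ z (f * g) n = (∑' n, _) * ∑' n, _
      rw [tsum_mul_tsum_eq_tsum_sum_antidiagonal_of_summable_norm
        (summable_norm_translateTerm φ z f) (summable_norm_translateTerm φ z g)]
      exact tsum_congr fun n => translateTerm_mul φ z f g n)
  continuous' := by
    obtain ⟨R, C, hR, hC, hφ⟩ := φ.exists_bound
    obtain ⟨r, hr, h0, h1⟩ := exists_translate_radius z
    exact continuous_of_bound _ (R + r) (2 * C) fun f M hf =>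
      norm_tsum_translateTerm_le hC hφ hr h1
        ((norm_nonneg _).trans (hf 0 (by simpa using by linarith))) hf

theorem Mb.hasSum_translate (φ : Mb E) (z : Bidual E) (f : Hb E) :
    HasSum (translateTerm φ z f) ((φ.translate z).toAlgHom f) :=
  (summable_norm_translateTerm φ z f).of_norm.hasSum

theorem Mb.ext_apply {φ ψ : Mb E} (h : ∀ f, φ.toAlgHom f = ψ.toAlgHom f) : φ = ψ := by
  cases φ; cases ψ
  congr
  exact AlgHom.ext h

theorem isTranslate_iff {φ ψ : Mb E} {z : Bidual E} : IsTranslate φ z ψ ↔ ψ = φ.translate z := by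
  simp only [IsTranslate, bidualDifferential_eq_pow]
  refine ⟨fun h => Mb.ext_apply fun f => (h f).unique (φ.hasSum_translate z f), ?_⟩
  rintro rfl f
  exact φ.hasSum_translate z f

theorem Mb.translate_zero (φ : Mb E) : φ.translate 0 = φ := by
  refine Mb.ext_apply fun f => ((φ.hasSum_translate 0 f).unique ?_)
  have h : φ.toAlgHom f = translateTerm φ 0 f 0 := by simp [translateTerm]
  rw [h]
  refine hasSum_single 0 fun n hn => ?_
  simp [translateTerm, hn]

theorem Mb.proj_translate (φ : Mb E) (z : Bidual E) : proj (φ.translate z) = proj φ + z := by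
  ext γ
  refine (φ.hasSum_translate z (ofDual γ)).unique ?_
  have h1 : translateTerm φ z (ofDual γ) 0 = proj φ γ := by
    simp only [translateTerm, pow_zero, Nat.factorial_zero, Nat.cast_one, inv_one, one_mul]
    rfl
  have h2 : translateTerm φ z (ofDual γ) 1 = z γ := by
    simp [translateTerm, directional_ofDual]
  -- `D_z γ` is the constant `z γ`, so the series stops after its linear term.
  have h3 := hasSum_sum_of_ne_finset_zero (f := translateTerm φ z (ofDual γ))
    (s := Finset.range 2) (L := SummationFilter.unconditional ℕ) fun n hn => by
      obtain ⟨m, rfl⟩ : ∃ m, n = m + 2 := ⟨n - 2, by simp at hn; omega⟩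
      rw [translateTerm, pow_add, Module.End.mul_apply, pow_two, Module.End.mul_apply,
        directional_ofDual, map_smul, directional_one, smul_zero, map_zero, map_zero, mul_zero]
  rwa [Finset.sum_range_succ, Finset.sum_range_one, h1, h2] at h3

/-- This is `exp(D_z) exp(D_w) = exp(D_z + D_w)`: an absolutely convergent double series is summed
by rows for the left side and along antidiagonals for the right side. -/
theorem Mb.translate_translate (φ : Mb E) {z w : Bidual E}
    (hzw : Commute (directional E z) (directional E w)) :
    (φ.translate z).translate w = φ.translate (z + w) := by
  refine Mb.ext_apply fun f => ?_
  obtain ⟨R, C, -, hC, hφ⟩ := φ.exists_bound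
  obtain ⟨r, hr, h0, h1⟩ := exists_translate_radius z
  obtain ⟨s, hs, h0', h1'⟩ := exists_translate_radius w
  -- The derivatives along `w` use up `s` of the radius, those along `z` use up `r`.
  obtain ⟨M, hM, hf⟩ := exists_boundedOnBall f (R + r + s)
  set F : ℕ × ℕ → ℂ := fun p =>
    (p.1.factorial : ℂ)⁻¹ * translateTerm φ z ((directional E w ^ p.1) f) p.2 with hF
  have hbound : ∀ p, ‖F p‖ ≤
      (Real.exp 1 * ‖w‖ / s) ^ p.1 * ((Real.exp 1 * ‖z‖ / r) ^ p.2 * (C * M)) := fun p => by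
    have h2 := norm_translateTerm_le hφ hr z (by positivity) (hf.directional_pow hs p.1 w hM) p.2
    rw [hF, norm_mul, norm_inv, Complex.norm_natCast, ← div_eq_inv_mul,
      div_le_iff₀ (by positivity)]
    exact h2.trans (le_of_eq (by ring))
  have hsum : Summable F := by
    refine Summable.of_norm_bounded ?_ hbound
    exact (summable_geometric_of_lt_one h0' (by linarith)).mul_of_nonneg
      ((summable_geometric_of_lt_one h0 (by linarith)).mul_right _)
      (fun n => by positivity) (fun n => by positivity)
  have hrow : ((φ.translate z).translate w).toAlgHom f = ∑' p, F p := by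
    refine ((φ.translate z).hasSum_translate w f).unique ?_
    refine HasSum.prod_fiberwise (f := F) hsum.hasSum fun m => ?_
    exact (φ.hasSum_translate z ((directional E w ^ m) f)).mul_left (m.factorial : ℂ)⁻¹
  have hdiag : (φ.translate (z + w)).toAlgHom f = ∑' p, F p := by
    refine (φ.hasSum_translate (z + w) f).unique ?_
    have h3 := (Finset.HasAntidiagonal.sigmaAntidiagonalEquivProd.hasSum_iff.2 hsum.hasSum).sigma
      fun n => hasSum_fintype _
    convert h3 using 2 with n
    change _ = ∑ b : Finset.HasAntidiagonal.antidiagonal n, F b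
    rw [Finset.sum_coe_sort (Finset.HasAntidiagonal.antidiagonal n) (fun p => F p), translateTerm, map_add,
      add_comm, hzw.symm.add_pow', LinearMap.sum_apply, map_sum, Finset.mul_sum]
    refine Finset.sum_congr rfl fun p hp => ?_
    obtain rfl := Finset.HasAntidiagonal.mem_antidiagonal.1 hp
    have h2 : ((p.1 + p.2).factorial : ℂ) ≠ 0 := by exact_mod_cast Nat.factorial_ne_zero _
    have h3 : (p.1.factorial : ℂ) ≠ 0 := by exact_mod_cast Nat.factorial_ne_zero _
    have h4 : (p.2.factorial : ℂ) ≠ 0 := by exact_mod_cast Nat.factorial_ne_zero _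
    have h5 : directional E w ^ p.1 * directional E z ^ p.2 =
        directional E z ^ p.2 * directional E w ^ p.1 := (hzw.symm.pow_pow _ _).eq
    rw [h5, LinearMap.smul_apply, Module.End.mul_apply, map_nsmul, nsmul_eq_mul,
      Nat.cast_add_choose]
    simp only [hF, translateTerm]
    field_simp
  rw [hrow, hdiag]

/-! ### Symmetric regularity -/

/-- Goldstine's theorem tested on finitely many functionals. A separating functional on `ι → ℂ` is a
combination `γ` of the `g i`; it would give `‖γ‖ ≤ -u` and `Re (z γ) < u`, against `‖z‖ ≤ 1`. -/
theorem mem_closure_image_closedBall {ι : Type*} [Finite ι] (g : ι → StrongDual ℂ E)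
    (z : Bidual E) (hz : ‖z‖ ≤ 1) :
    (fun i => z (g i)) ∈ closure ((fun (x : E) i => g i x) '' Metric.closedBall 0 1) := by
  classical
  have := Fintype.ofFinite ι
  by_contra hmem
  have hconv : Convex ℝ (closure ((fun (x : E) i => g i x) '' Metric.closedBall 0 1)) := by
    let _ : NormedSpace ℝ E := NormedSpace.restrictScalars ℝ ℂ E
    refine Convex.closure ?_
    exact (convex_closedBall (0 : E) 1).linear_image
      ((LinearMap.pi fun i => (g i).toLinearMap : E →ₗ[ℂ] ι → ℂ).restrictScalars ℝ)
  obtain ⟨f, u, hfu, hf⟩ := RCLike.geometric_hahn_banach_point_closed (𝕜 := ℂ) hconv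
    isClosed_closure hmem
  set γ : StrongDual ℂ E := ∑ i, f (Pi.single i 1) • g i with hγ
  have hsum : ∀ v : ι → ℂ, f v = ∑ i, f (Pi.single i 1) * v i := fun v => by
    conv_lhs => rw [← Finset.univ_sum_single v]
    rw [map_sum]
    refine Finset.sum_congr rfl fun i _ => ?_
    have : (Pi.single i (v i) : ι → ℂ) = v i • Pi.single i 1 := by
      rw [← Pi.single_smul, smul_eq_mul, mul_one]
    rw [this, map_smul, smul_eq_mul, mul_comm]
  have hzγ : f (fun i => z (g i)) = z γ := by
    rw [hsum, hγ, map_sum]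
    simp
  have hxγ : ∀ x, f (fun i => g i x) = γ x := fun x => by
    rw [hsum, hγ, _root_.sum_apply]
    simp
  have hx : ∀ x : E, ‖x‖ ≤ 1 → u < (γ x).re := fun x hx => by
    have := hf _ (subset_closure ⟨x, by simpa using hx, rfl⟩)
    rwa [hxγ] at this
  have hu : u < 0 := by simpa using hx 0 (by simp)
  have hnorm : ‖γ‖ ≤ -u := by
    refine ContinuousLinearMap.opNorm_le_of_unit_norm (𝕜 := ℂ) (by linarith) fun x hx1 => ?_
    rcases eq_or_ne (γ x) 0 with h0 | h0
    · rw [h0, norm_zero]; linarith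
    have hn : (‖γ x‖ : ℂ) ≠ 0 := by exact_mod_cast norm_ne_zero_iff.2 h0
    -- Rotating `x` makes the value of `γ` equal to `-‖γ x‖`.
    have h2 := hx (-((starRingEnd ℂ) (γ x) / ‖γ x‖) • x) (by
      rw [norm_smul, norm_neg, norm_div, RCLike.norm_conj, Complex.norm_real, norm_norm, hx1,
        mul_one, div_self (norm_ne_zero_iff.2 h0)])
    have h3 : γ (-((starRingEnd ℂ) (γ x) / ‖γ x‖) • x) = ((-‖γ x‖ : ℝ) : ℂ) := by
      rw [map_smul, smul_eq_mul, neg_mul, div_mul_eq_mul_div, mul_comm, Complex.mul_conj,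
        Complex.normSq_eq_norm_sq]
      push_cast
      field_simp
    rw [h3, Complex.ofReal_re] at h2
    linarith
  have h4 : ‖z γ‖ ≤ -u := (z.le_opNorm γ).trans <| by
    calc ‖z‖ * ‖γ‖ ≤ 1 * ‖γ‖ := by gcongr
      _ ≤ -u := by rwa [one_mul]
  rw [hzγ] at hfu
  have h5 := (abs_le.1 (Complex.abs_re_le_norm (z γ))).1
  have h6 : (z γ).re < u := hfu
  linarith

/-- A weakly compact operator has a bitranspose with values in the range space. -/
theorem exists_apply_eq_of_isCompact {T : E →L[ℂ] StrongDual ℂ E}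
    (hT : IsCompact (closure (toWeakSpace ℂ (StrongDual ℂ E) '' (T '' Metric.closedBall 0 1))))
    (z : Bidual E) (hz : ‖z‖ ≤ 1) : ∃ γ : StrongDual ℂ E, ∀ w : Bidual E, w γ = z (w.comp T) := by
  -- The conditions on `γ`, one for each `w`, are weakly closed. Finitely many of them can be met in
  -- the compact set `closure S`, whose image in `ℂ^u` is closed, by the finite Goldstine lemma;
  -- compactness then meets all of them at once.
  set S := toWeakSpace ℂ (StrongDual ℂ E) '' (T '' Metric.closedBall 0 1)
  have hcont : ∀ w : Bidual E, Continuous fun κ : WeakSpace ℂ (StrongDual ℂ E) =>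
      w ((toWeakSpace ℂ (StrongDual ℂ E)).symm κ) := fun w =>
    WeakBilin.eval_continuous (topDualPairing ℂ (StrongDual ℂ E)).flip w
  obtain ⟨κ, -, hκ⟩ := hT.inter_iInter_nonempty
    (fun w : Bidual E => {κ | w ((toWeakSpace ℂ (StrongDual ℂ E)).symm κ) = z (w.comp T)})
    (fun w => isClosed_eq (hcont w) continuous_const) (fun u => by
      let Φ : WeakSpace ℂ (StrongDual ℂ E) → (u → ℂ) := fun κ w =>
        (w : Bidual E) ((toWeakSpace ℂ (StrongDual ℂ E)).symm κ)
      have hΦ : Continuous Φ := continuous_pi fun w => hcont w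
      have h1 := mem_closure_image_closedBall (fun w : u => (w : Bidual E).comp T) z hz
      have h2 : closure ((fun (x : E) (w : u) => (w : Bidual E).comp T x) ''
          Metric.closedBall 0 1) ⊆ Φ '' closure S := by
        refine closure_minimal ?_ (hT.image hΦ).isClosed
        rintro _ ⟨x, hx, rfl⟩
        exact ⟨_, subset_closure ⟨_, ⟨x, hx, rfl⟩, rfl⟩, rfl⟩
      obtain ⟨κ, hκ, hκ'⟩ := h2 h1
      exact ⟨κ, hκ, mem_iInter₂.2 fun w hw => congrFun hκ' ⟨w, hw⟩⟩)
  exact ⟨(toWeakSpace ℂ (StrongDual ℂ E)).symm κ, fun w => mem_iInter.1 hκ w⟩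

/-- Weak compactness represents `w ↦ z (w.comp T)` by some `γ ∈ E'`. Testing on `w = x ∈ E` and
using the symmetry of `T` identifies `γ` with `z.comp T`. -/
theorem SymmetricallyRegular.apply_comp_comm (hE : SymmetricallyRegular E)
    {T : E →L[ℂ] StrongDual ℂ E} (hT : ∀ x y, T x y = T y x) (z w : Bidual E) :
    z (w.comp T) = w (z.comp T) := by
  have unit : ∀ z : Bidual E, ‖z‖ ≤ 1 → z (w.comp T) = w (z.comp T) := fun z hz => by
    obtain ⟨γ, hγ⟩ := exists_apply_eq_of_isCompact (hE T hT) z hz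
    rw [← hγ w]
    congr 1
    ext x
    have h1 := hγ (NormedSpace.inclusionInDoubleDual ℂ E x)
    rw [NormedSpace.dual_def] at h1
    rw [h1, ContinuousLinearMap.comp_apply]
    congr 1
    ext y
    exact hT y x
  rcases eq_or_ne z 0 with rfl | hz
  · simp
  have hn : (‖z‖ : ℂ) ≠ 0 := by exact_mod_cast norm_ne_zero_iff.2 hz
  have h1 := unit ((‖z‖ : ℂ)⁻¹ • z) (by
    rw [norm_smul, norm_inv, Complex.norm_real, norm_norm,
      inv_mul_cancel₀ (norm_ne_zero_iff.2 hz)])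
  rw [ContinuousLinearMap.smul_comp, _root_.smul_apply, map_smul] at h1
  exact smul_right_injective ℂ (inv_ne_zero hn) h1

theorem SymmetricallyRegular.commute_directional (hE : SymmetricallyRegular E) (z w : Bidual E) :
    Commute (directional E z) (directional E w) := by
  refine LinearMap.ext fun f => Subtype.ext <| funext fun y => ?_
  have hf : HasFDerivAt (fderiv ℂ (f : E → ℂ)) (fderiv ℂ (fderiv ℂ (f : E → ℂ)) y) y :=
    (f.2.1.fderiv y (mem_univ y)).differentiableAt.hasFDerivAt
  have key : ∀ w : Bidual E, fderiv ℂ (directional E w f : E → ℂ) y =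
      w.comp (fderiv ℂ (fderiv ℂ (f : E → ℂ)) y) := fun w =>
    (w.hasFDerivAt.comp y hf).fderiv
  change z (fderiv ℂ (directional E w f : E → ℂ) y) = w (fderiv ℂ (directional E z f : E → ℂ) y)
  rw [key, key]
  refine hE.apply_comp_comm (fun a b => ?_) z w
  exact (f.2.1.contDiff.contDiffAt (x := y) (n := 2)).isSymmSndFDerivAt (by simp) a b

theorem SymmetricallyRegular.translate_translate (hE : SymmetricallyRegular E) (φ : Mb E)
    (z w : Bidual E) : (φ.translate z).translate w = φ.translate (z + w) :=
  φ.translate_translate (hE.commute_directional z w)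

/-! ### The topology of the spectrum -/

theorem isOpen_translate_image_ball (φ : Mb E) {ε : ℝ} (hε : 0 < ε) :
    IsOpen (φ.translate '' Metric.ball 0 ε) := by
  refine TopologicalSpace.isOpen_generateFrom_of_mem ⟨φ, ε, hε, ?_⟩
  ext ψ
  simp only [isTranslate_iff, mem_image, mem_ball_zero_iff, mem_ofPred_eq, eq_comm]

theorem translate_image_ball_mem_nhds (φ : Mb E) {ε : ℝ} (hε : 0 < ε) :
    φ.translate '' Metric.ball 0 ε ∈ 𝓝 φ :=
  (isOpen_translate_image_ball φ hε).mem_nhds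
    ⟨0, Metric.mem_ball_self hε, φ.translate_zero⟩

theorem continuous_proj : Continuous (proj : Mb E → Bidual E) := by
  refine continuous_iff_continuousAt.2 fun φ => Metric.tendsto_nhds.2 fun ε hε => ?_
  filter_upwards [translate_image_ball_mem_nhds φ hε]
  rintro _ ⟨z, hz, rfl⟩
  rw [Mb.proj_translate, dist_eq_norm, add_sub_cancel_left]
  exact mem_ball_zero_iff.1 hz

theorem SymmetricallyRegular.continuous_translate (hE : SymmetricallyRegular E) (φ : Mb E) :
    Continuous φ.translate := by
  refine continuous_generateFrom_iff.2 ?_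
  rintro _ ⟨ψ, ε, hε, rfl⟩
  simp only [isTranslate_iff]
  refine Metric.isOpen_iff.2 fun z ⟨w, hw, hzw⟩ => ⟨ε - ‖w‖, by linarith, fun v hv => ?_⟩
  rw [Metric.mem_ball, dist_eq_norm] at hv
  -- If `φ^z = ψ^w`, then `φ^v = ψ^(w + v - z)`.
  refine ⟨w + (v - z), (norm_add_le _ _).trans_lt (by linarith), ?_⟩
  rw [← hE.translate_translate, ← hzw, hE.translate_translate, add_sub_cancel]

/-- By the group law the orbits partition the spectrum, and each contains a neighbourhood of each of
its points. -/
theorem SymmetricallyRegular.isClopen_range_translate (hE : SymmetricallyRegular E) (φ : Mb E) :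
    IsClopen (range φ.translate) := by
  have hopen : ∀ ψ : Mb E, range ψ.translate ∈ 𝓝 ψ := fun ψ =>
    mem_of_superset (translate_image_ball_mem_nhds ψ one_pos) (image_subset_range _ _)
  constructor
  · refine isOpen_compl_iff.1 (isOpen_iff_mem_nhds.2 fun ψ hψ => mem_of_superset (hopen ψ) ?_)
    rintro _ ⟨w, rfl⟩ ⟨z, hz⟩
    refine hψ ⟨z + -w, ?_⟩
    rw [← hE.translate_translate, hz, hE.translate_translate, add_neg_cancel, Mb.translate_zero]
  · refine isOpen_iff_mem_nhds.2 ?_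
    rintro _ ⟨z, rfl⟩
    refine mem_of_superset (hopen _) ?_
    rintro _ ⟨w, rfl⟩
    exact ⟨z + w, (hE.translate_translate φ z w).symm⟩

theorem SymmetricallyRegular.isEmbedding_proj (hE : SymmetricallyRegular E) (φ : Mb E) :
    IsEmbedding ((range φ.translate).domRestrict (proj : Mb E → Bidual E)) := by
  refine IsEmbedding.of_leftInverse
    (f := fun y => ⟨φ.translate (y - proj φ), mem_range_self _⟩) ?_ ?_
    (continuous_proj.comp continuous_subtype_val)
  · rintro ⟨_, z, rfl⟩
    refine Subtype.ext ?_
    change φ.translate (proj (φ.translate z) - proj φ) = φ.translate z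
    rw [Mb.proj_translate, add_sub_cancel_left]
  · exact ((hE.continuous_translate φ).comp (continuous_id.sub continuous_const)).subtype_mk _

/-- As `r` is arbitrary, the boundary distance is infinite at every point. -/
theorem SymmetricallyRegular.le_boundaryDist (hE : SymmetricallyRegular E) (φ : Mb E) {r : ℝ}
    (hr : 0 < r) : ENNReal.ofReal r ≤ boundaryDist proj φ := by
  refine le_iSup₂_of_le r ⟨hr, φ.translate '' Metric.ball 0 r,
    translate_image_ball_mem_nhds φ hr, ?_, ?_⟩ le_rfl
  · exact (hE.isEmbedding_proj φ).comp (IsEmbedding.inclusion (image_subset_range _ _))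
  · rw [image_image]
    simp only [Mb.proj_translate]
    ext y
    simp only [mem_image, Metric.mem_ball, dist_eq_norm, sub_zero]
    refine ⟨?_, fun h => ⟨y - proj φ, h, add_sub_cancel _ _⟩⟩
    rintro ⟨z, hz, rfl⟩
    rwa [add_sub_cancel_left]

/-! ### Canonical extensions on the spectrum -/

theorem isHolomorphic_canonicalExtension (f : Hb E) :
    IsHolomorphic proj (canonicalExtension f) := by
  intro φ
  obtain ⟨R, C, -, hC, hφ⟩ := φ.exists_bound
  -- A loss of radius `e` makes the factor `(e / r)^n` equal to `1`, so the forms `A n` are bounded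
  -- uniformly in `n`.
  obtain ⟨M, hM, hf⟩ := exists_boundedOnBall f (R + Real.exp 1)
  let A : ∀ n : ℕ, MultilinearMap ℂ (fun _ : Fin n => Bidual E) ℂ := fun n =>
    (n.factorial : ℂ)⁻¹ • (φ.toAlgHom.toLinearMap ∘ₗ LinearMap.applyₗ f).compMultilinearMap
      ((MultilinearMap.mkPiAlgebraFin ℂ n (Module.End ℂ (Hb E))).compLinearMap
        fun _ => directional E)
  have hA : ∀ n (z : Fin n → Bidual E), A n z = (n.factorial : ℂ)⁻¹ *
      φ.toAlgHom ((List.ofFn fun i => directional E (z i)).prod f) := fun n z => by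
    simp [A]
  have hbound : ∀ n (z : Fin n → Bidual E), ‖A n z‖ ≤ (C * M) * ∏ i, ‖z i‖ := fun n z => by
    have h := hφ _ _ (hf.directional_ofFn (Real.exp_pos 1) z hM)
    rw [hA, norm_mul, norm_inv, Complex.norm_natCast, ← div_eq_inv_mul,
      div_le_iff₀ (by positivity)]
    refine h.trans (le_of_eq ?_)
    rw [div_self (Real.exp_pos 1).ne', one_pow]
    ring
  let p : FormalMultilinearSeries ℂ (Bidual E) ℂ := fun n => (A n).mkContinuous (C * M) (hbound n)
  have hp : 0 < p.radius := by
    refine lt_of_lt_of_le one_pos (p.le_radius_of_bound (r := 1) (C * M) fun n => ?_)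
    rw [NNReal.coe_one, one_pow, mul_one]
    exact (A n).mkContinuous_norm_le (by positivity) (hbound n)
  refine ⟨fun w => p.sum (w - proj φ), ?_, ?_⟩
  · have h1 : AnalyticAt ℂ p.sum (proj φ - proj φ) := by
      rw [sub_self]; exact (p.hasFPowerSeriesOnBall hp).analyticAt
    exact h1.comp (f := fun w => w - proj φ) (analyticAt_id.sub analyticAt_const)
  · filter_upwards [translate_image_ball_mem_nhds φ one_pos]
    rintro _ ⟨z, -, rfl⟩
    rw [Function.comp_apply, Mb.proj_translate, add_sub_cancel_left]
    change (φ.translate z).toAlgHom f = ∑' n, p n fun _ => z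
    rw [← (φ.hasSum_translate z f).tsum_eq]
    refine tsum_congr fun n => ?_
    change _ = A n fun _ => z
    rw [hA, List.ofFn_const, List.prod_replicate, translateTerm]

theorem exists_bound_canonicalExtension_translate (φ : Mb E) (f : Hb E) (ρ : ℝ) :
    ∃ C : ℝ, ∀ z : Bidual E, ‖z‖ ≤ ρ → ‖canonicalExtension f (φ.translate z)‖ ≤ C := by
  obtain ⟨R, C, -, hC, hφ⟩ := φ.exists_bound
  set r : ℝ := 2 * (Real.exp 1 * |ρ| + 1) with hr
  have hr0 : 0 < r := by positivity
  obtain ⟨M, hM, hf⟩ := exists_boundedOnBall f (R + r)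
  refine ⟨2 * C * M, fun z hz => norm_tsum_translateTerm_le hC hφ hr0 ?_ hM hf⟩
  rw [div_le_div_iff₀ hr0 two_pos, hr]
  have : Real.exp 1 * ‖z‖ ≤ Real.exp 1 * |ρ| := by gcongr; exact hz.trans (le_abs_self ρ)
  linarith

theorem SymmetricallyRegular.isOfBoundedType_component (hE : SymmetricallyRegular E) (φ : Mb E)
    (f : Hb E) : IsOfBoundedType
      (fun ψ : connectedComponent φ => proj (ψ : Mb E))
      (fun ψ : connectedComponent φ => canonicalExtension f ψ) := by
  refine ⟨fun ψ => ?_, fun A hA => ?_⟩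
  · obtain ⟨g, hg, hfg⟩ := isHolomorphic_canonicalExtension f (ψ : Mb E)
    exact ⟨g, hg, continuous_subtype_val.continuousAt.eventually hfg⟩
  · obtain ⟨ρ, hρ⟩ := hA.1.subset_closedBall (proj φ)
    obtain ⟨C, hC⟩ := exists_bound_canonicalExtension_translate φ f ρ
    refine ⟨C, fun ψ hψ => ?_⟩
    -- The sheet lies in the orbit of `φ`, so its points over a ball around `π(φ)` are translates
    -- `φ^z` with `‖z‖ ≤ ρ`.
    have hsub := (hE.isClopen_range_translate φ).connectedComponent_subset
      ⟨0, φ.translate_zero⟩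
    obtain ⟨z, hz⟩ := hsub ψ.2
    have h1 := hρ (mem_image_of_mem _ hψ)
    rw [← hz, Mb.proj_translate, Metric.mem_closedBall, dist_eq_norm, add_sub_cancel_left] at h1
    change ‖canonicalExtension f (ψ : Mb E)‖ ≤ C
    rw [← hz]
    exact hC z h1

/-! ### Evaluation along ultrafilters -/

/-- Each `f ∈ H_b(E)` maps `B` into a compact disc, so it has a limit along `U`; limits respect sums
and products. -/
theorem exists_mb_of_ultrafilter (U : Ultrafilter E) {B : Set E} (hB : Bornology.IsBounded B)
    (hU : B ∈ U) : ∃ φ : Mb E, ∀ f : Hb E, Tendsto (f : E → ℂ) U (𝓝 (φ.toAlgHom f)) := by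
  have hlim : ∀ (f : Hb E) (M : ℝ), (∀ x ∈ B, ‖(f : E → ℂ) x‖ ≤ M) →
      ∃ c ∈ Metric.closedBall (0 : ℂ) M, Tendsto (f : E → ℂ) U (𝓝 c) := fun f M hf => by
    have := (isCompact_closedBall (0 : ℂ) M).ultrafilter_le_nhds' (U.map (f : E → ℂ))
      (Ultrafilter.mem_map.2 (mem_of_superset hU fun x hx => by simpa using hf x hx))
    exact this
  have hlim' : ∀ f : Hb E, ∃ c, Tendsto (f : E → ℂ) U (𝓝 c) := fun f => by
    obtain ⟨M, hM⟩ := f.2.2 B hB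
    obtain ⟨c, -, hc⟩ := hlim f M hM
    exact ⟨c, hc⟩
  choose φ hφ using hlim'
  obtain ⟨R, hR⟩ := hB.subset_closedBall 0
  let Φ : Hb E →ₐ[ℂ] ℂ := AlgHom.ofLinearMap
    { toFun := φ
      map_add' := fun f g => tendsto_nhds_unique (hφ (f + g)) ((hφ f).add (hφ g))
      map_smul' := fun c f => tendsto_nhds_unique (hφ (c • f)) ((hφ f).const_smul c) }
    (tendsto_nhds_unique (hφ 1) tendsto_const_nhds)
    (fun f g => tendsto_nhds_unique (hφ (f * g)) ((hφ f).mul (hφ g)))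
  refine ⟨⟨Φ, continuous_of_bound Φ R 1 fun f M hf => ?_⟩, hφ⟩
  obtain ⟨c, hc, hfc⟩ := hlim f M fun x hx => hf x (by simpa using hR hx)
  have : Φ f = c := tendsto_nhds_unique (hφ f) hfc
  rw [this, one_mul]
  simpa using hc

theorem IsHomogeneousPolynomial.mem_hb {n : ℕ} {P : E → ℂ} (hP : IsHomogeneousPolynomial n P) :
    P ∈ Hb E := by
  obtain ⟨A, hA⟩ := hP
  obtain rfl : P = fun x => A fun _ => x := funext hA
  refine ⟨fun x _ => ?_, fun B hB => ?_⟩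
  · have h1 : AnalyticAt ℂ A (fun _ : Fin n => x) := A.analyticAt
    exact h1.comp (f := fun x : E => fun _ : Fin n => x)
      ((ContinuousLinearMap.pi fun _ : Fin n => ContinuousLinearMap.id ℂ E).analyticAt x)
  · obtain ⟨R, hR⟩ := hB.subset_closedBall 0
    refine ⟨‖A‖ * R ^ n, fun x hx => (A.le_opNorm _).trans ?_⟩
    have hxR : ‖x‖ ≤ R := by simpa using hR hx
    rw [Finset.prod_const, Finset.card_univ, Fintype.card_fin]
    gcongr

theorem IsHomogeneousPolynomial.map_smul {n : ℕ} {P : E → ℂ} (hP : IsHomogeneousPolynomial n P)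
    (c : ℂ) (x : E) : P (c • x) = c ^ n * P x := by
  obtain ⟨A, hA⟩ := hP
  rw [hA, hA, A.map_smul_univ (fun _ => c) fun _ => x]
  simp

/-! ### Polynomials which are not weakly continuous on bounded sets -/

/-- `P` converges to `P x₀` along each bounded ultrafilter converging weakly to `x₀`. -/
def ContinuousAlongBoundedUltrafilters (P : E → ℂ) : Prop :=
  ∀ (U : Ultrafilter E) (x₀ : E), (∃ B ∈ U, Bornology.IsBounded B) →
    (∀ γ : StrongDual ℂ E, Tendsto γ U (𝓝 (γ x₀))) → Tendsto P U (𝓝 (P x₀))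

theorem ContinuousAlongBoundedUltrafilters.weaklyContinuousOnBoundedSets {P : E → ℂ}
    (hP : ContinuousAlongBoundedUltrafilters P) : WeaklyContinuousOnBoundedSets P := by
  rintro B hB _ ⟨x₀, hx₀, rfl⟩
  refine tendsto_iff_ultrafilter _ _ _ |>.2 fun g hg => ?_
  have h1 : (toWeakSpace ℂ E) '' B ∈ g := hg self_mem_nhdsWithin
  have h2 : (g : Filter (WeakSpace ℂ E)) ≤ 𝓝 (toWeakSpace ℂ E x₀) :=
    hg.trans nhdsWithin_le_nhds
  refine hP (g.map (toWeakSpace ℂ E).symm) x₀ ⟨B, mem_of_superset h1 ?_, hB⟩ fun γ => ?_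
  · rintro _ ⟨x, hx, rfl⟩
    exact hx
  · have hγ : Continuous fun x : WeakSpace ℂ E => γ ((toWeakSpace ℂ E).symm x) :=
      WeakBilin.eval_continuous (topDualPairing ℂ E).flip γ
    exact (hγ.tendsto (toWeakSpace ℂ E x₀)).mono_left h2

theorem IsContinuousPolynomial.exists_homogeneous {P : E → ℂ} (hP : IsContinuousPolynomial P)
    (h : ¬ WeaklyContinuousOnBoundedSets P) : ∃ (n : ℕ) (Q : E → ℂ),
      IsHomogeneousPolynomial n Q ∧ ¬ ContinuousAlongBoundedUltrafilters Q := by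
  obtain ⟨d, Q, hQ, hPQ⟩ := hP
  by_contra! hcon
  refine h (ContinuousAlongBoundedUltrafilters.weaklyContinuousOnBoundedSets
    fun U x₀ hB hU => ?_)
  rw [funext hPQ]
  exact tendsto_finsetSum _ fun n _ => hcon n (Q n) (hQ n) U x₀ hB hU

theorem isHomogeneousPolynomial_piecewise {n : ℕ}
    (A : ContinuousMultilinearMap ℂ (fun _ : Fin n => E) ℂ) (s : Finset (Fin n)) (x₀ : E) :
    IsHomogeneousPolynomial s.card fun x => A (s.piecewise (fun _ => x) fun _ => x₀) := by
  refine ⟨⟨A.toMultilinearMap.restr s rfl x₀, ?_⟩, fun x => ?_⟩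
  · change Continuous fun v : Fin s.card → E => A fun j => if h : j ∈ s then
      v ((s.orderIsoOfFin rfl).symm ⟨j, h⟩) else x₀
    refine A.cont.comp (continuous_pi fun j => ?_)
    split_ifs
    · exact continuous_apply _
    · exact continuous_const
  · change _ = A fun j => if h : j ∈ s then x else x₀
    congr 1

/-- A homogeneous polynomial of minimal degree which is not weakly continuous on bounded sets
fails to be so at the origin. -/
theorem exists_weaklyNull_ultrafilter (h : ∃ (n : ℕ) (Q : E → ℂ),
    IsHomogeneousPolynomial n Q ∧ ¬ ContinuousAlongBoundedUltrafilters Q) :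
    ∃ (n : ℕ) (Q : E → ℂ) (V : Ultrafilter E) (c : ℂ), n ≠ 0 ∧ IsHomogeneousPolynomial n Q ∧
      (∃ B ∈ V, Bornology.IsBounded B) ∧ (∀ γ : StrongDual ℂ E, Tendsto γ V (𝓝 0)) ∧
      c ≠ 0 ∧ Tendsto Q V (𝓝 c) := by
  classical
  obtain ⟨Q, hQ, hnot⟩ := Nat.find_spec h
  set n := Nat.find h with hn
  have hmin : ∀ m < n, ∀ P : E → ℂ, IsHomogeneousPolynomial m P →
      ContinuousAlongBoundedUltrafilters P := fun m hm P hP => by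
    by_contra hcon
    exact Nat.find_min h hm ⟨P, hP, hcon⟩
  have hn0 : n ≠ 0 := fun h0 => hnot fun U x₀ _ _ => by
    have hconst : ∀ x, Q x = Q 0 := fun x => by
      have := hQ.map_smul 0 x
      rw [zero_smul, h0, pow_zero, one_mul] at this
      exact this.symm
    rw [funext hconst]
    exact tendsto_const_nhds
  have hQ0 : Q 0 = 0 := by
    have := hQ.map_smul 0 0
    rwa [zero_smul, zero_pow hn0, zero_mul] at this
  simp only [ContinuousAlongBoundedUltrafilters, not_forall] at hnot
  obtain ⟨U, x₀, ⟨B, hBU, hB⟩, hU, hlim⟩ := hnot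
  -- This supplies a limit `φ(Q)` of `Q` along `U`; by the choice of `U` it differs from `Q x₀`.
  obtain ⟨φ, hφ⟩ := exists_mb_of_ultrafilter U hB hBU
  obtain ⟨A, hA⟩ := id hQ
  set V := U.map fun x => x - x₀ with hV
  have hVB : ∃ B ∈ V, Bornology.IsBounded B := by
    obtain ⟨R, hR⟩ := hB.subset_closedBall x₀
    refine ⟨Metric.closedBall 0 R, Ultrafilter.mem_map.2 (mem_of_superset hBU fun x hx => ?_),
      Metric.isBounded_closedBall⟩
    have := hR hx
    rw [Metric.mem_closedBall, dist_eq_norm] at this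
    simpa using this
  have hVγ : ∀ γ : StrongDual ℂ E, Tendsto γ V (𝓝 0) := fun γ => by
    have h1 := (hU γ).sub_const (γ x₀)
    rw [sub_self] at h1
    rw [hV, Ultrafilter.coe_map, tendsto_map'_iff]
    refine Tendsto.congr (fun x => ?_) h1
    rw [Function.comp_apply, map_sub]
  have hadd : ∀ h : E, Q (h + x₀) =
      Q h + ∑ s ∈ Finset.univ.erase (Finset.univ : Finset (Fin n)),
        A (s.piecewise (fun _ => h) fun _ => x₀) := fun h => by
    rw [hA, hA]
    have h1 := A.toMultilinearMap.map_add_univ (fun _ : Fin n => h) (fun _ => x₀)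
    rw [← Finset.add_sum_erase _ _ (Finset.mem_univ (Finset.univ : Finset (Fin n))),
      Finset.piecewise_univ] at h1
    exact h1
  -- Each mixed term is a homogeneous polynomial in `h` of degree below `n`, so by minimality it
  -- converges along `V` to its value at `0`. These values add up to `Q x₀`, by `hadd` at `h = 0`.
  -- Hence `Q` tends to `φ(Q) - Q x₀ ≠ 0` along `V`.
  have hmixed : Tendsto (fun h : E => ∑ s ∈ Finset.univ.erase (Finset.univ : Finset (Fin n)),
      A (s.piecewise (fun _ => h) fun _ => x₀)) V (𝓝 (Q x₀)) := by
    have h1 := hadd 0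
    rw [zero_add, hQ0, zero_add] at h1
    rw [h1]
    refine tendsto_finsetSum _ fun s hs => ?_
    have hcard : s.card < n := by
      have := Finset.card_lt_card (Finset.ssubset_univ_iff.2 (Finset.ne_of_mem_erase hs))
      rwa [Finset.card_univ, Fintype.card_fin] at this
    exact hmin _ hcard _ (isHomogeneousPolynomial_piecewise A s x₀) V 0 hVB
      fun γ => by rw [map_zero]; exact hVγ γ
  have hQV : Tendsto (fun h : E => Q (h + x₀)) V (𝓝 (φ.toAlgHom ⟨Q, hQ.mem_hb⟩)) := by
    rw [hV, Ultrafilter.coe_map, tendsto_map'_iff]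
    refine Tendsto.congr (fun x => ?_) (hφ ⟨Q, hQ.mem_hb⟩)
    rw [Function.comp_apply, sub_add_cancel]
  refine ⟨n, Q, V, φ.toAlgHom ⟨Q, hQ.mem_hb⟩ - Q x₀, hn0, hQ, hVB, hVγ, fun hc => hlim ?_, ?_⟩
  · rw [← sub_eq_zero.1 hc]
    exact hφ ⟨Q, hQ.mem_hb⟩
  · refine Tendsto.congr (fun h => ?_) (hQV.sub hmixed)
    rw [hadd, add_sub_cancel_right]

/-- Dilating `V` by `k` keeps it weakly null but multiplies the limit of `Q` by `k^n`: the fibre of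
`π` over `0` is `X`-bounded, yet the extension of `Q` is unbounded on it. -/
theorem SymmetricallyRegular.not_isOfBoundedType (hE : SymmetricallyRegular E) {n : ℕ}
    (hn : n ≠ 0) (Q : Hb E) (hQ : IsHomogeneousPolynomial n (Q : E → ℂ)) {V : Ultrafilter E}
    {B : Set E} (hBV : B ∈ V) (hB : Bornology.IsBounded B)
    (hV : ∀ γ : StrongDual ℂ E, Tendsto γ V (𝓝 0)) {c : ℂ} (hc : c ≠ 0)
    (hQV : Tendsto (Q : E → ℂ) V (𝓝 c)) :
    ¬ IsOfBoundedType proj (canonicalExtension Q) := by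
  rintro ⟨-, hbdd⟩
  have hex : ∀ k : ℕ, ∃ φ : Mb E, proj φ = 0 ∧ φ.toAlgHom Q = (k : ℂ) ^ n * c := fun k => by
    obtain ⟨φ, hφ⟩ := exists_mb_of_ultrafilter (V.map fun x => (k : ℂ) • x) (hB.smul₀ (k : ℂ))
      (Ultrafilter.mem_map.2 (mem_of_superset hBV fun x hx => smul_mem_smul_set hx))
    refine ⟨φ, ?_, ?_⟩
    · ext γ
      refine tendsto_nhds_unique (hφ (ofDual γ)) ?_
      have h1 := (hV γ).const_mul (k : ℂ)
      rw [mul_zero] at h1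
      rw [Ultrafilter.coe_map, tendsto_map'_iff]
      refine Tendsto.congr (fun x => ?_) h1
      exact (γ.map_smul (k : ℂ) x).symm
    · refine tendsto_nhds_unique (hφ Q) ?_
      rw [Ultrafilter.coe_map, tendsto_map'_iff]
      refine Tendsto.congr (fun x => ?_) (hQV.const_mul ((k : ℂ) ^ n))
      exact (hQ.map_smul (k : ℂ) x).symm
  choose φ hφ hφQ using hex
  obtain ⟨C, hC⟩ := hbdd (range φ) ⟨by
      refine (Bornology.isBounded_singleton (x := (0 : Bidual E))).subset ?_
      rintro _ ⟨_, ⟨k, rfl⟩, rfl⟩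
      exact hφ k,
    lt_of_lt_of_le (by simp) (le_iInf₂ fun ψ _ => hE.le_boundaryDist ψ one_pos)⟩
  have hbig : ∀ k : ℕ, 1 ≤ k → (k : ℝ) * ‖c‖ ≤ C := fun k hk => by
    have h1 := hC (φ k) (mem_range_self k)
    rw [canonicalExtension, hφQ, norm_mul, norm_pow, Complex.norm_natCast] at h1
    refine le_trans ?_ h1
    gcongr
    exact le_self_pow₀ (by exact_mod_cast hk) hn
  obtain ⟨k, hk⟩ := exists_nat_gt (C / ‖c‖)
  rw [div_lt_iff₀ (norm_pos_iff.2 hc)] at hk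
  -- The shift to `k + 1` secures `1 ≤ k`, needed for `k ≤ k^n`.
  have h2 := hbig (k + 1) (by omega)
  push_cast at h2
  linarith [norm_nonneg c]

end HbSpectrum

end

theorem mainTheorem10 {E : Type*} [NormedAddCommGroup E] [NormedSpace ℂ E] [CompleteSpace E]
    (hE : HbSpectrum.SymmetricallyRegular E)
    (hP : ∃ P : E → ℂ, HbSpectrum.IsContinuousPolynomial P ∧
      ¬ HbSpectrum.WeaklyContinuousOnBoundedSets P) :
    ∃ (n : ℕ) (Q : HbSpectrum.Hb E),
      HbSpectrum.IsHomogeneousPolynomial n (Q : E → ℂ) ∧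
      HbSpectrum.IsHolomorphic HbSpectrum.proj (HbSpectrum.canonicalExtension Q) ∧
      ¬ HbSpectrum.IsOfBoundedType HbSpectrum.proj (HbSpectrum.canonicalExtension Q) ∧
      ∀ φ : HbSpectrum.Mb E,
        HbSpectrum.IsOfBoundedType
          (fun ψ : connectedComponent φ => HbSpectrum.proj (ψ : HbSpectrum.Mb E))
          (fun ψ : connectedComponent φ => HbSpectrum.canonicalExtension Q ψ) := by
  obtain ⟨P, hPpoly, hPnot⟩ := hP
  obtain ⟨n, Q, V, c, hn, hQ, ⟨B, hBV, hB⟩, hV, hc, hQV⟩ :=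
    HbSpectrum.exists_weaklyNull_ultrafilter (hPpoly.exists_homogeneous hPnot)
  exact ⟨n, ⟨Q, hQ.mem_hb⟩, hQ, HbSpectrum.isHolomorphic_canonicalExtension _,
    hE.not_isOfBoundedType hn _ hQ hBV hB hV hc hQV,
    fun φ => hE.isOfBoundedType_component φ _⟩
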